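/- Let $K$ be a field of characteristic $0$ with algebraic closure $\bar K$, and let $E: y^2=x^3+ax+b$ and $F: y^2=x^3+cx+d$ be elliptic curves over $K$ with $j(E)\neq j(F)$. Put $\Delta(E)=-16(4a^3+27b^2)$, $\Delta(F)=-16(4c^3+27d^2)$ and $B(t)=\Delta(F)\,t+864\,bd+\Delta(E)/t$. For an integer $i\geq 1$ let $\pi_i:X_i\to\mathbf{P}^1$ be the elliptic surface associated to the Weierstrass equation \[ y^2=x^3-48ac\,x+B(t^i), \] and let $MW(\pi_i)=MW_{\bar K}(\pi_i)$ be its Mordell--Weil group over $\bar K$, i.e. the group of sections of $\pi_i$ over $\bar K$, identified with the group of $\bar K(t)$-rational points of the generic fibre, the elliptic curve over $\bar K(t)$ given by this equation. Then for every $i\geq 1$ the group $MW(\pi_i)$ is torsion-free. -/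

import Mathlib

noncomputable section

/-- The short Weierstrass curve `y² = x³ + a x + b`. -/
def shortWeierstrass {R : Type*} [CommRing R] (a b : R) : WeierstrassCurve R :=
  ⟨0, 0, 0, a, b⟩

/-- For `E : y² = x³ + a x + b` and `F : y² = x³ + c x + d` over `k`, the element
`B(s) = Δ(F) s + 864 b d + Δ(E) / s` of the field `k(t)`, for `s` in `k(t)`. -/
def kuwataB {k : Type*} [Field k] (a b c d : k) (s : RatFunc k) : RatFunc k :=
  RatFunc.C (shortWeierstrass c d).Δ * s + RatFunc.C (864 * b * d)
    + RatFunc.C (shortWeierstrass a b).Δ / s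

/-- The generic fibre of the elliptic surface `π_i : X_i → ℙ¹` over `k`: the cubic
`y² = x³ - 48 a c x + B(t^i)` over the function field `k(t)` of `ℙ¹`. -/
def kuwataCurve {k : Type*} [Field k] (a b c d : k) (i : ℕ) : WeierstrassCurve (RatFunc k) :=
  shortWeierstrass (RatFunc.C (-48 * a * c)) (kuwataB a b c d (RatFunc.X ^ i))

/-- The generic fibre of `π_i` is an elliptic curve over `k(t)`; in particular each of its points
is nonsingular. -/
theorem kuwataCurve_isElliptic {k : Type*} [Field k] [CharZero k] (a b c d : k)
    (hE : (shortWeierstrass a b).Δ ≠ 0) {i : ℕ} (hi : 1 ≤ i) :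
    (kuwataCurve a b c d i).IsElliptic := by
  refine ⟨isUnit_iff_ne_zero.mpr fun h => hE ?_⟩
  have hX : (RatFunc.X : RatFunc k) ^ i ≠ 0 := pow_ne_zero _ RatFunc.X_ne_zero
  have hD : (kuwataCurve a b c d i).Δ = -16 * (4 * RatFunc.C (-48 * a * c) ^ 3
      + 27 * kuwataB a b c d (RatFunc.X ^ i) ^ 2) := by
    simp only [kuwataCurve, shortWeierstrass, WeierstrassCurve.Δ, WeierstrassCurve.b₂,
      WeierstrassCurve.b₄, WeierstrassCurve.b₆, WeierstrassCurve.b₈]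
    ring
  have hB : kuwataB a b c d (RatFunc.X ^ i) * RatFunc.X ^ i
      = RatFunc.C (shortWeierstrass c d).Δ * RatFunc.X ^ (2 * i)
        + RatFunc.C (864 * b * d) * RatFunc.X ^ i + RatFunc.C (shortWeierstrass a b).Δ := by
    rw [kuwataB]
    field_simp
    ring
  set D := (shortWeierstrass a b).Δ
  set D' := (shortWeierstrass c d).Δ
  have key : -16 * (4 * (RatFunc.C (-48 * a * c)) ^ 3 * RatFunc.X ^ (2 * i)
      + 27 * (RatFunc.C D' * RatFunc.X ^ (2 * i) + RatFunc.C (864 * b * d) * RatFunc.X ^ i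
        + RatFunc.C D) ^ 2) = (0 : RatFunc k) := by
    rw [← hB]
    have : (kuwataCurve a b c d i).Δ * RatFunc.X ^ (2 * i) = 0 := by rw [h, zero_mul]
    rw [hD] at this
    rw [← this]
    ring
  have key' : (-16 * (4 * (Polynomial.C (-48 * a * c)) ^ 3 * Polynomial.X ^ (2 * i)
      + 27 * (Polynomial.C D' * Polynomial.X ^ (2 * i) + Polynomial.C (864 * b * d)
        * Polynomial.X ^ i + Polynomial.C D) ^ 2) : Polynomial k) = 0 := by
    apply RatFunc.algebraMap_injective k
    rw [map_zero, ← key]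
    simp only [map_mul, map_add, map_pow, map_neg, map_ofNat, RatFunc.algebraMap_C,
      RatFunc.algebraMap_X]
  have := congrArg (Polynomial.eval 0) key'
  simpa [show i ≠ 0 by omega] using this

/-- The Mordell-Weil group `MW(π_i) = MW_K̄(π_i)` of the elliptic surface `π_i` attached to
`E : y² = x³ + a x + b` and `F : y² = x³ + c x + d` over `K`: sections of `π_i` over an algebraic
closure `K̄` of `K` are the `K̄(t)`-rational points of the generic fibre. -/
def KuwataMW {K : Type*} [Field K] (a b c d : K) (i : ℕ) : Type _ :=
  (kuwataCurve (algebraMap K (AlgebraicClosure K) a) (algebraMap K (AlgebraicClosure K) b)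
    (algebraMap K (AlgebraicClosure K) c) (algebraMap K (AlgebraicClosure K) d) i).toAffine.Point

open scoped Classical in
/-- The group law on `MW(π_i)` is the chord-tangent law on the generic fibre, with the point at
infinity (the zero section) as identity element. -/
instance {K : Type*} [Field K] (a b c d : K) (i : ℕ) : AddCommGroup (KuwataMW a b c d i) :=
  inferInstanceAs (AddCommGroup (kuwataCurve (algebraMap K (AlgebraicClosure K) a)
    (algebraMap K (AlgebraicClosure K) b) (algebraMap K (AlgebraicClosure K) c)
    (algebraMap K (AlgebraicClosure K) d) i).toAffine.Point)

end

open WeierstrassCurve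

/-! For an affine torsion point `(x, y)`, let `f = y`, or `f = 3x² + A` (with `A = -48ac`) when `y =
0`. The claim is that `f` has neither zeros nor poles on the multiplicative group, but a pole at
both `0` and `∞`. A function of the first kind is `c·tⁿ`, whose orders at `0` and `∞` are opposite:
a contradiction.

The local input is `not_isOfFinAddOrder_of_dominant`: in residue characteristic zero, a point whose
`x` dominates the coefficients has infinite order. Applied to the point and to its double, it bounds
their `x`-coordinates. Away from `0` and `∞`, a zero of `f` would then force the section through a
singular point of the fibre, so that `B(tⁱ)` takes a critical value `2e³` to second order; this
gives `a³d² = b²c³`, hence `j(E) = j(F)`. At `0` and `∞`, the pole of `B` forces one of `f`. -/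

theorem shortWeierstrass_equation_iff {R : Type*} [CommRing R] {A B x y : R} :
    (shortWeierstrass A B).toAffine.Equation x y ↔ y ^ 2 = x ^ 3 + A * x + B := by
  rw [Affine.equation_iff]
  simp [shortWeierstrass]

theorem exists_two_nsmul_eq_some {F : Type*} [Field F] [DecidableEq F] [CharZero F] {A B x y : F}
    (h : (shortWeierstrass A B).toAffine.Nonsingular x y) (hy : y ≠ 0) :
    ∃ y' h', 2 • Affine.Point.some x y h =
      Affine.Point.some (((3 * x ^ 2 + A) / (2 * y)) ^ 2 - 2 * x) y' h' := by
  have hy' : y ≠ (shortWeierstrass A B).toAffine.negY x y := by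
    simp only [shortWeierstrass, Affine.negY]
    intro h
    apply hy
    linear_combination h / 2
  rw [two_nsmul, Affine.Point.add_self_of_Y_ne hy']
  have hX : (shortWeierstrass A B).toAffine.addX x x
      ((shortWeierstrass A B).toAffine.slope x x y y) =
      ((3 * x ^ 2 + A) / (2 * y)) ^ 2 - 2 * x := by
    rw [Affine.slope_of_Y_ne rfl hy']
    simp only [shortWeierstrass, Affine.addX, Affine.negY]
    ring
  have aux : ∀ {q r : F} (h' : (shortWeierstrass A B).toAffine.Nonsingular q r),
      q = ((3 * x ^ 2 + A) / (2 * y)) ^ 2 - 2 * x → ∃ y' h'', Affine.Point.some q r h' =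
        Affine.Point.some (((3 * x ^ 2 + A) / (2 * y)) ^ 2 - 2 * x) y' h'' := by
    rintro q r h' rfl
    exact ⟨_, h', rfl⟩
  exact aux _ hX

/-! ### Torsion points under a valuation of residue characteristic zero. -/

section Valuation

variable {F : Type*} [Field F] {Γ₀ : Type*} [LinearOrderedCommGroupWithZero Γ₀]
  (v : Valuation F Γ₀) {A B x y : F}

theorem valuation_sq_of_dominant (h : y ^ 2 = x ^ 3 + A * x + B)
    (hA : v A < v x ^ 2) (hB : v B < v x ^ 3) : v y ^ 2 = v x ^ 3 := by
  have hx : 0 < v x := by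
    rw [zero_lt_iff]
    intro h0
    simp [h0] at hA
  have hAx : v (A * x) < v x ^ 3 := by
    rw [map_mul, pow_succ]
    exact mul_lt_mul_of_pos_right hA hx
  rw [← map_pow, h, add_assoc, v.map_add_eq_of_lt_left, map_pow]
  rw [map_pow]
  exact v.map_add_lt hAx hB

/-- Near infinity on the curve, doubling is `x ↦ x/4` to leading order: the `x⁴` terms of `(3x² +
A)² - 9xy²` cancel. -/
theorem valuation_four_mul_double_sub_lt (hv : ∀ n : ℕ, n ≠ 0 → v n = 1)
    (h : y ^ 2 = x ^ 3 + A * x + B) (hA : v A < v x ^ 2) (hB : v B < v x ^ 3) :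
    y ≠ 0 ∧ v (4 * (((3 * x ^ 2 + A) / (2 * y)) ^ 2 - 2 * x) - x) < v x := by
  have hx : 0 < v x := by
    rw [zero_lt_iff]
    intro h0
    simp [h0] at hA
  have hvy := valuation_sq_of_dominant v h hA hB
  have hy : y ≠ 0 := by
    rintro rfl
    simp only [map_zero, ne_eq, OfNat.ofNat_ne_zero, not_false_eq_true, zero_pow] at hvy
    exact (pow_pos hx 3).ne hvy
  refine ⟨hy, ?_⟩
  have h2 : (2 : F) ≠ 0 := by
    intro h0
    have := hv 2 two_ne_zero
    simp [h0] at this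
  have key : (4 * (((3 * x ^ 2 + A) / (2 * y)) ^ 2 - 2 * x) - x) * y ^ 2
      = A * A - (3 * (A * x ^ 2) + 9 * (B * x)) := by
    have : (4 * (((3 * x ^ 2 + A) / (2 * y)) ^ 2 - 2 * x) - x) * y ^ 2
      = (3 * x ^ 2 + A) ^ 2 - 9 * x * y ^ 2 := by
      field_simp
      ring
    rw [this, h]
    ring
  have h3 : v 3 = 1 := by simpa using hv 3 (by norm_num)
  have h9 : v 9 = 1 := by simpa using hv 9 (by norm_num)
  have hlt : v (A * A - (3 * (A * x ^ 2) + 9 * (B * x))) < v x ^ 4 := by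
    refine v.map_sub_lt ?_ (v.map_add_lt ?_ ?_)
    · rw [map_mul, show v x ^ 4 = v x ^ 2 * v x ^ 2 by rw [← pow_add]]
      exact mul_lt_mul'' hA hA zero_le zero_le
    · rw [map_mul, map_mul, h3, one_mul, map_pow, show v x ^ 4 = v x ^ 2 * v x ^ 2 by rw [← pow_add]]
      exact mul_lt_mul_of_pos_right hA (pow_pos hx 2)
    · rw [map_mul, map_mul, h9, one_mul, pow_succ]
      exact mul_lt_mul_of_pos_right hB hx
  rw [← key, map_mul, map_pow, hvy, pow_succ' (v x) 3] at hlt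
  exact lt_of_mul_lt_mul_right hlt zero_le

theorem valuation_eq_of_four_pow_mul_sub_lt (hv : ∀ n : ℕ, n ≠ 0 → v n = 1) {k : ℕ} {q : F}
    (h : v (4 ^ k * q - x) < v x) : v q = v x := by
  have h4 : v 4 = 1 := by simpa using hv 4 (by norm_num)
  have := v.map_add_eq_of_lt_right h
  simpa [h4] using this

/-- The points `2^k • P` have `x`-coordinates with leading terms `x/4^k`, which are pairwise
distinct, so `P` has infinitely many multiples. -/
theorem not_isOfFinAddOrder_of_dominant [DecidableEq F] [CharZero F]
    (hv : ∀ n : ℕ, n ≠ 0 → v n = 1)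
    (h : (shortWeierstrass A B).toAffine.Nonsingular x y) (hA : v A < v x ^ 2)
    (hB : v B < v x ^ 3) : ¬ IsOfFinAddOrder (Affine.Point.some x y h) := by
  intro hfin
  have h4 : v 4 = 1 := by simpa using hv 4 (by norm_num)
  have hx : v x ≠ 0 := by
    intro h0
    simp [h0] at hA
  have main : ∀ k : ℕ, ∃ q r hqr, 2 ^ k • Affine.Point.some x y h = Affine.Point.some q r hqr ∧
      v (4 ^ k * q - x) < v x := by
    intro k
    induction k with
    | zero => exact ⟨x, y, h, by simp, by simpa [zero_lt_iff] using hx⟩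
    | succ k ih =>
      obtain ⟨q, r, hqr, hP, hq⟩ := ih
      have hqx := valuation_eq_of_four_pow_mul_sub_lt v hv hq
      obtain ⟨hr, hlt⟩ := valuation_four_mul_double_sub_lt v hv
        (shortWeierstrass_equation_iff.mp hqr.1) (hqx ▸ hA) (hqx ▸ hB)
      obtain ⟨r', hr', hP'⟩ := exists_two_nsmul_eq_some hqr hr
      refine ⟨_, r', hr', by rw [pow_succ, mul_nsmul, hP, hP'], ?_⟩
      set q' := ((3 * q ^ 2 + A) / (2 * r)) ^ 2 - 2 * q
      rw [show 4 ^ (k + 1) * q' - x = 4 ^ k * (4 * q' - q) + (4 ^ k * q - x) by ring]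
      refine v.map_add_lt ?_ hq
      rwa [map_mul, map_pow, h4, one_pow, one_mul, ← hqx]
  have : Finite (AddSubmonoid.multiples (Affine.Point.some x y h)) := hfin.finite_multiples
  obtain ⟨k, l, hkl, heq⟩ := Finite.exists_ne_map_eq_of_infinite
    (fun k : ℕ => (⟨2 ^ k • Affine.Point.some x y h, 2 ^ k, rfl⟩ :
      AddSubmonoid.multiples (Affine.Point.some x y h)))
  have heq' : 2 ^ k • Affine.Point.some x y h = 2 ^ l • Affine.Point.some x y h :=
    congrArg Subtype.val heq
  clear heq
  wlog hlt : k < l generalizing k l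
  · exact this l k hkl.symm heq'.symm (by omega)
  obtain ⟨q, r, hqr, hP, hq⟩ := main k
  obtain ⟨q', r', hqr', hP', hq'⟩ := main l
  rw [hP, hP', Affine.Point.some.injEq] at heq'
  obtain ⟨rfl, -⟩ := heq'
  have hqx := valuation_eq_of_four_pow_mul_sub_lt v hv hq
  -- A common `x`-coordinate `q` would make `(4^l - 4^k) q` smaller than `x`, although the integer
  -- factor is a unit and `v q = v x`.
  have hn : 4 ^ k < 4 ^ l := Nat.pow_lt_pow_right (by norm_num) hlt
  have h1 := v.map_sub_lt hq' hq
  rw [show 4 ^ l * q - x - (4 ^ k * q - x) = ((4 ^ l - 4 ^ k : ℕ) : F) * q by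
    rw [Nat.cast_sub hn.le]; push_cast; ring, map_mul, hv _ (by omega), one_mul, hqx] at h1
  exact h1.false

theorem valuation_le_one_of_isOfFinAddOrder [DecidableEq F] [CharZero F]
    (hv : ∀ n : ℕ, n ≠ 0 → v n = 1) (hA : v A ≤ 1) (hB : v B ≤ 1)
    {h : (shortWeierstrass A B).toAffine.Nonsingular x y}
    (hfin : IsOfFinAddOrder (Affine.Point.some x y h)) : v x ≤ 1 := by
  by_contra! hx
  exact not_isOfFinAddOrder_of_dominant v hv h (hA.trans_lt (one_lt_pow₀ hx (by norm_num)))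
    (hB.trans_lt (one_lt_pow₀ hx (by norm_num))) hfin

/-- At a place of good or irreducible multiplicative reduction, a torsion point of order greater
than two never meets the zeros of `y`, unless it passes through the singular point. -/
theorem valuation_tangent_lt_one [DecidableEq F] [CharZero F]
    (hv : ∀ n : ℕ, n ≠ 0 → v n = 1) (hA : v A ≤ 1) (hB : v B ≤ 1)
    {h : (shortWeierstrass A B).toAffine.Nonsingular x y}
    (hfin : IsOfFinAddOrder (Affine.Point.some x y h)) (hy : y ≠ 0) (hvy : v y < 1) :
    v (3 * x ^ 2 + A) < 1 := by
  have h2 : v 2 = 1 := by simpa using hv 2 (by norm_num)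
  have hx := valuation_le_one_of_isOfFinAddOrder v hv hA hB hfin
  obtain ⟨y', h', hP⟩ := exists_two_nsmul_eq_some h hy
  have hx' := valuation_le_one_of_isOfFinAddOrder v hv hA hB (hP ▸ hfin.nsmul)
  -- The squared tangent slope is `x(2P) + 2x`, a sum of integral terms.
  have hs : v (((3 * x ^ 2 + A) / (2 * y)) ^ 2) ≤ 1 := by
    rw [← sub_add_cancel (((3 * x ^ 2 + A) / (2 * y)) ^ 2) (2 * x)]
    exact v.map_add_le hx' (by rwa [map_mul, h2, one_mul])
  rw [map_pow, pow_le_one_iff_of_nonneg zero_le two_ne_zero, map_div₀, map_mul, h2, one_mul,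
    div_le_one₀ (zero_lt_iff.mpr ((v.ne_zero_iff).mpr hy))] at hs
  exact hs.trans_lt hvy

theorem valuation_cube_le_of_isOfFinAddOrder [DecidableEq F] [CharZero F]
    (hv : ∀ n : ℕ, n ≠ 0 → v n = 1) (hA : v A ≤ 1) (hB : 1 < v B)
    {h : (shortWeierstrass A B).toAffine.Nonsingular x y}
    (hfin : IsOfFinAddOrder (Affine.Point.some x y h)) : v x ^ 3 ≤ v B := by
  by_contra! hx
  have hx1 : 1 < v x := by
    by_contra! h1
    exact (hB.trans (hx.trans_le (pow_le_one₀ zero_le h1))).false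
  exact not_isOfFinAddOrder_of_dominant v hv h (hA.trans_lt (one_lt_pow₀ hx1 (by norm_num))) hx
    hfin

theorem valuation_cube_eq_of_sq_lt (hA : v A ≤ 1) (hB : 1 < v B) (h : y ^ 2 = x ^ 3 + A * x + B)
    (hx : v x ^ 3 ≤ v B) (hy : v y ^ 2 < v B) : v x ^ 3 = v B := by
  have hAx : v (A * x) < v B := by
    rw [map_mul]
    refine (mul_le_of_le_one_left zero_le hA).trans_lt ?_
    rcases le_or_gt (v x) 1 with h1 | h1
    · exact h1.trans_lt hB
    · exact (lt_self_pow₀ h1 (by norm_num)).trans_le hx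
  have hlt : v (y ^ 2 - A * x) < v (-B) := by
    rw [Valuation.map_neg]
    exact v.map_sub_lt (by rwa [map_pow]) hAx
  rw [← map_pow, show x ^ 3 = y ^ 2 - A * x + -B by rw [h]; ring, v.map_add_eq_of_lt_right hlt,
    Valuation.map_neg]

/-- If `y²` were smaller than `B`, then `x³` would balance `B` and the tangent would be so steep
that `x(2P)` exceeds the bound for torsion points. -/
theorem valuation_sq_eq_of_isOfFinAddOrder [DecidableEq F] [CharZero F]
    (hv : ∀ n : ℕ, n ≠ 0 → v n = 1) (hA : v A ≤ 1) (hB : 1 < v B)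
    {h : (shortWeierstrass A B).toAffine.Nonsingular x y}
    (hfin : IsOfFinAddOrder (Affine.Point.some x y h)) (hy : y ≠ 0) : v y ^ 2 = v B := by
  have h2 : v 2 = 1 := by simpa using hv 2 (by norm_num)
  have h3 : v 3 = 1 := by simpa using hv 3 (by norm_num)
  have heq := shortWeierstrass_equation_iff.mp h.1
  have hx := valuation_cube_le_of_isOfFinAddOrder v hv hA hB hfin
  have hle : v y ^ 2 ≤ v B := by
    have hAx : v (A * x) ≤ v B := by
      rw [map_mul]
      refine (mul_le_of_le_one_left zero_le hA).trans ?_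
      rcases le_or_gt (v x) 1 with h1 | h1
      · exact h1.trans hB.le
      · exact (le_self_pow₀ h1.le (by norm_num)).trans hx
    rw [← map_pow, heq]
    exact v.map_add_le (v.map_add_le (by rwa [map_pow]) hAx) le_rfl
  by_contra hne
  have hlt := lt_of_le_of_ne hle hne
  have hx3 := valuation_cube_eq_of_sq_lt v hA hB heq hx hlt
  have hx1 : 1 < v x := by
    by_contra! h1
    exact (hB.trans_le (hx3 ▸ pow_le_one₀ zero_le h1)).false
  have hvy : 0 < v y := zero_lt_iff.mpr ((v.ne_zero_iff).mpr hy)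
  have htan : v (3 * x ^ 2 + A) = v x ^ 2 := by
    rw [v.map_add_eq_of_lt_left, map_mul, h3, one_mul, map_pow]
    rw [map_mul, h3, one_mul, map_pow]
    exact hA.trans_lt (one_lt_pow₀ hx1 (by norm_num))
  have hs : v x < v (((3 * x ^ 2 + A) / (2 * y)) ^ 2) := by
    rw [map_pow, map_div₀, map_mul, h2, one_mul, htan, div_pow, lt_div_iff₀ (pow_pos hvy 2)]
    calc v x * v y ^ 2 < v x * v B := mul_lt_mul_of_pos_left hlt (zero_lt_one.trans hx1)
      _ = (v x ^ 2) ^ 2 := by rw [← hx3, ← pow_succ', ← pow_mul]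
  obtain ⟨y', h', hP⟩ := exists_two_nsmul_eq_some h hy
  have hx' := valuation_cube_le_of_isOfFinAddOrder v hv hA hB (hP ▸ hfin.nsmul)
  rw [v.map_sub_eq_of_lt_left (by rwa [map_mul, h2, one_mul]), ← hx3] at hx'
  exact (pow_lt_pow_left₀ hs zero_le three_ne_zero).not_ge hx'

end Valuation


/-! ### Places of the rational function field. -/

namespace Kuwata
open Polynomial IsDedekindDomain WithZero

variable {k : Type*} [Field k]

/-- The point `t₀` of the affine line, as a prime of `k[t]`. -/
noncomputable def affinePlace (t₀ : k) : HeightOneSpectrum k[X] where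
  asIdeal := Ideal.span {X - C t₀}
  isPrime := (Ideal.span_singleton_prime (X_sub_C_ne_zero t₀)).mpr (prime_X_sub_C t₀)
  ne_bot := by simpa using X_sub_C_ne_zero t₀

/-- The valuation of `k(t)` at the point `t₀` of the affine line. -/
noncomputable abbrev placeValuation (t₀ : k) : Valuation (RatFunc k) ℤᵐ⁰ :=
  (affinePlace t₀).valuation (RatFunc k)

theorem placeValuation_polynomial_le_one (t₀ : k) (p : k[X]) :
    placeValuation t₀ (algebraMap k[X] (RatFunc k) p) ≤ 1 :=
  (affinePlace t₀).valuation_le_one p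

theorem placeValuation_polynomial_lt_one_iff {t₀ : k} {p : k[X]} :
    placeValuation t₀ (algebraMap k[X] (RatFunc k) p) < 1 ↔ p.eval t₀ = 0 := by
  rw [placeValuation, HeightOneSpectrum.valuation_of_algebraMap,
    HeightOneSpectrum.intValuation_lt_one_iff_mem]
  change p ∈ Ideal.span {X - C t₀} ↔ _
  rw [Ideal.mem_span_singleton, dvd_iff_isRoot, IsRoot.def]

theorem placeValuation_polynomial_eq_one {t₀ : k} {p : k[X]} (hp : p.eval t₀ ≠ 0) :
    placeValuation t₀ (algebraMap k[X] (RatFunc k) p) = 1 :=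
  le_antisymm (placeValuation_polynomial_le_one t₀ p)
    (not_lt.mp fun h => hp (placeValuation_polynomial_lt_one_iff.mp h))

theorem sq_dvd_of_placeValuation_le {t₀ : k} {p : k[X]}
    (hp : placeValuation t₀ (algebraMap k[X] (RatFunc k) p) ≤ exp (-2 : ℤ)) :
    (X - C t₀) ^ 2 ∣ p := by
  rw [placeValuation, HeightOneSpectrum.valuation_of_algebraMap] at hp
  have := ((affinePlace t₀).intValuation_le_pow_iff_mem p 2).mp hp
  change p ∈ Ideal.span {X - C t₀} ^ 2 at this
  rwa [Ideal.span_singleton_pow, Ideal.mem_span_singleton] at this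

theorem placeValuation_C (t₀ : k) {c : k} (hc : c ≠ 0) :
    placeValuation t₀ (RatFunc.C c) = 1 := by
  rw [← RatFunc.algebraMap_C]
  exact placeValuation_polynomial_eq_one (by simpa)

theorem placeValuation_X {t₀ : k} (ht : t₀ ≠ 0) : placeValuation t₀ (RatFunc.X : RatFunc k) = 1 := by
  rw [← RatFunc.algebraMap_X]
  exact placeValuation_polynomial_eq_one (by simpa)

theorem placeValuation_zero_X : placeValuation 0 (RatFunc.X : RatFunc k) = exp (-1 : ℤ) := by
  rw [← RatFunc.algebraMap_X, placeValuation, HeightOneSpectrum.valuation_of_algebraMap,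
    HeightOneSpectrum.intValuation_singleton _ X_ne_zero]
  simp [affinePlace]

theorem denom_eval_ne_zero {t₀ : k} {f : RatFunc k} (hf : placeValuation t₀ f ≤ 1) :
    f.denom.eval t₀ ≠ 0 := by
  intro h0
  have hnum : f.num.eval t₀ ≠ 0 := by
    intro h1
    have hu := f.isCoprime_num_denom.isUnit_of_dvd' (dvd_iff_isRoot.mpr h1) (dvd_iff_isRoot.mpr h0)
    exact not_isUnit_X_sub_C t₀ hu
  have hlt := placeValuation_polynomial_lt_one_iff.mpr h0
  rw [← RatFunc.num_div_denom f, map_div₀, placeValuation_polynomial_eq_one hnum,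
    div_le_one₀ (zero_lt_iff.mpr ?_)] at hf
  · exact hlt.not_ge hf
  · simpa using f.denom_ne_zero

theorem exists_placeValuation_sub_C_lt {t₀ : k} {f : RatFunc k} (hf : placeValuation t₀ f ≤ 1) :
    ∃ c : k, placeValuation t₀ (f - RatFunc.C c) < 1 := by
  have h0 := denom_eval_ne_zero hf
  refine ⟨f.num.eval t₀ / f.denom.eval t₀, ?_⟩
  set c := f.num.eval t₀ / f.denom.eval t₀ with hc
  have hd : algebraMap k[X] (RatFunc k) f.denom ≠ 0 := by simpa using f.denom_ne_zero
  have : f - RatFunc.C c = algebraMap k[X] (RatFunc k) (f.num - C c * f.denom) /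
      algebraMap k[X] (RatFunc k) f.denom := by
    rw [map_sub, map_mul, RatFunc.algebraMap_C, sub_div, RatFunc.num_div_denom,
      mul_div_cancel_right₀ _ hd]
  rw [this, map_div₀, placeValuation_polynomial_eq_one h0, div_one,
    placeValuation_polynomial_lt_one_iff]
  simp [hc, h0]

theorem eq_C_mul_X_pow [IsAlgClosed k] {p : k[X]} (hp : ∀ t, t ≠ 0 → p.eval t ≠ 0) :
    p = C p.leadingCoeff * X ^ p.natDegree := by
  have hs := IsAlgClosed.splits p
  have hr : p.roots = Multiset.replicate p.roots.card 0 := by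
    rw [Multiset.eq_replicate_card]
    intro t ht
    by_contra h0
    exact hp t h0 (isRoot_of_mem_roots ht)
  conv_lhs => rw [hs.eq_prod_roots, hr]
  simp [hs.natDegree_eq_card_roots]

/-- Without zeros and poles on the multiplicative group, the orders at `0` and `∞` are opposite. -/
theorem placeValuation_zero_mul_inftyValuation [IsAlgClosed k] [DecidableEq (RatFunc k)]
    {f : RatFunc k} (hf : ∀ t₀ : k, t₀ ≠ 0 → placeValuation t₀ f = 1) :
    placeValuation 0 f * RatFunc.inftyValuation k f = 1 := by
  have hd : ∀ t, t ≠ 0 → f.denom.eval t ≠ 0 := fun t ht => denom_eval_ne_zero (hf t ht).le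
  have hn : ∀ t, t ≠ 0 → f.num.eval t ≠ 0 := by
    intro t ht h0
    have h1 := placeValuation_polynomial_lt_one_iff.mpr h0
    have h2 := hf t ht
    rw [← RatFunc.num_div_denom f, map_div₀, placeValuation_polynomial_eq_one (hd t ht),
      div_one] at h2
    exact h1.ne h2
  have monomial : ∀ p : k[X], (∀ t, t ≠ 0 → p.eval t ≠ 0) →
      placeValuation 0 (algebraMap k[X] (RatFunc k) p) *
        RatFunc.inftyValuation k (algebraMap k[X] (RatFunc k) p) = 1 := by
    intro p hp
    have hlc : p.leadingCoeff ≠ 0 := by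
      intro h0
      rw [leadingCoeff_eq_zero] at h0
      exact hp 1 one_ne_zero (by simp [h0])
    rw [eq_C_mul_X_pow hp, map_mul, map_pow, RatFunc.algebraMap_C, RatFunc.algebraMap_X,
      map_mul, map_mul, map_pow, map_pow, placeValuation_C _ hlc, placeValuation_zero_X,
      RatFunc.inftyValuation.C _ hlc, RatFunc.inftyValuation.X, one_mul, one_mul, ← mul_pow,
      ← exp_add]
    simp
  rw [← RatFunc.num_div_denom f, map_div₀, map_div₀, div_mul_div_comm, monomial _ hn,
    monomial _ hd, div_one]

end Kuwata


/-! ### Local behaviour of `B(tⁱ)` and the global contradiction. -/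

namespace Kuwata
open Polynomial WithZero

variable {k : Type*} [Field k]

theorem placeValuation_natCast [CharZero k] (t₀ : k) (n : ℕ) (hn : n ≠ 0) :
    placeValuation t₀ (n : RatFunc k) = 1 := by
  rw [← map_natCast (RatFunc.C (K := k)) n]
  exact placeValuation_C t₀ (Nat.cast_ne_zero.mpr hn)

theorem inftyValuation_natCast [CharZero k] [DecidableEq (RatFunc k)] (n : ℕ) (hn : n ≠ 0) :
    RatFunc.inftyValuation k (n : RatFunc k) = 1 := by
  rw [← map_natCast (RatFunc.C (K := k)) n]
  exact RatFunc.inftyValuation.C _ (Nat.cast_ne_zero.mpr hn)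

theorem placeValuation_C_le_one (t₀ c : k) : placeValuation t₀ (RatFunc.C c) ≤ 1 := by
  rw [← RatFunc.algebraMap_C]
  exact placeValuation_polynomial_le_one t₀ _

theorem inftyValuation_C_le_one [DecidableEq (RatFunc k)] (c : k) :
    RatFunc.inftyValuation k (RatFunc.C c) ≤ 1 := by
  by_cases hc : c = 0
  · simp [hc]
  · exact (RatFunc.inftyValuation.C _ hc).le

theorem eq_zero_of_placeValuation_C_lt_one {t₀ c : k} (h : placeValuation t₀ (RatFunc.C c) < 1) :
    c = 0 := by
  by_contra hc
  exact h.ne (placeValuation_C t₀ hc)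

theorem placeValuation_kuwataB_le_one (a b c d : k) (i : ℕ) {t₀ : k} (ht : t₀ ≠ 0) :
    placeValuation t₀ (kuwataB a b c d (RatFunc.X ^ i)) ≤ 1 := by
  have hX : placeValuation t₀ ((RatFunc.X : RatFunc k) ^ i) = 1 := by
    rw [map_pow, placeValuation_X ht, one_pow]
  refine Valuation.map_add_le _ (Valuation.map_add_le _ ?_ (placeValuation_C_le_one _ _)) ?_
  · rw [map_mul, hX, mul_one]
    exact placeValuation_C_le_one _ _
  · rw [map_div₀, hX, div_one]
    exact placeValuation_C_le_one _ _

theorem one_lt_placeValuation_zero_kuwataB {a b c d : k} (hE : (shortWeierstrass a b).Δ ≠ 0)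
    {i : ℕ} (hi : 1 ≤ i) : 1 < placeValuation 0 (kuwataB a b c d (RatFunc.X ^ i)) := by
  have hX : placeValuation 0 ((RatFunc.X : RatFunc k) ^ i) < 1 := by
    rw [map_pow, placeValuation_zero_X]
    exact pow_lt_one₀ zero_le (by rw [← exp_zero, exp_lt_exp]; norm_num) (by omega)
  have hX0 : 0 < placeValuation 0 ((RatFunc.X : RatFunc k) ^ i) := by
    rw [zero_lt_iff, Valuation.ne_zero_iff]
    exact pow_ne_zero _ RatFunc.X_ne_zero
  have hlast : 1 < placeValuation 0
      (RatFunc.C (shortWeierstrass a b).Δ / (RatFunc.X : RatFunc k) ^ i) := by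
    rwa [map_div₀, placeValuation_C _ hE, one_lt_div₀ hX0]
  rw [kuwataB, Valuation.map_add_eq_of_lt_right _ (lt_of_le_of_lt _ hlast)]
  · exact hlast
  · refine Valuation.map_add_le _ ?_ (placeValuation_C_le_one _ _)
    rw [map_mul]
    exact mul_le_one' (placeValuation_C_le_one _ _) hX.le

theorem one_lt_inftyValuation_kuwataB [DecidableEq (RatFunc k)] {a b c d : k}
    (hF : (shortWeierstrass c d).Δ ≠ 0) {i : ℕ} (hi : 1 ≤ i) :
    1 < RatFunc.inftyValuation k (kuwataB a b c d (RatFunc.X ^ i)) := by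
  have hX : 1 < RatFunc.inftyValuation k ((RatFunc.X : RatFunc k) ^ i) := by
    rw [map_pow, RatFunc.inftyValuation.X]
    exact one_lt_pow₀ (by rw [← exp_zero, exp_lt_exp]; norm_num) (by omega)
  have hfirst : 1 < RatFunc.inftyValuation k
      (RatFunc.C (shortWeierstrass c d).Δ * (RatFunc.X : RatFunc k) ^ i) := by
    rwa [map_mul, RatFunc.inftyValuation.C _ hF, one_mul]
  rw [kuwataB, add_assoc, Valuation.map_add_eq_of_lt_left _ (lt_of_le_of_lt _ hfirst)]
  · exact hfirst
  · refine Valuation.map_add_le _ (inftyValuation_C_le_one _) ?_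
    rw [map_div₀]
    exact div_le_one_of_le₀ ((inftyValuation_C_le_one _).trans hX.le) zero_le

theorem shortWeierstrass_Δ (a b : k) :
    (shortWeierstrass a b).Δ = -16 * (4 * a ^ 3 + 27 * b ^ 2) := by
  simp only [shortWeierstrass, Δ, b₂, b₄, b₆, b₈]
  ring

/-- `B(t^i)` cannot take to second order at `t₀ ≠ 0` a value `2 e³` for which the cubic
`x³ - 48 a c x + 2 e³` has the double root `e`. -/
theorem not_placeValuation_kuwataB_sub_C_le [CharZero k] {a b c d e : k} (hne : a ^ 3 * d ^ 2 ≠ b ^ 2 * c ^ 3)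
    {i : ℕ} (hi : 1 ≤ i) {t₀ : k} (ht : t₀ ≠ 0) (he : 3 * e ^ 2 + -48 * a * c = 0) :
    ¬ placeValuation t₀ (kuwataB a b c d (RatFunc.X ^ i) - RatFunc.C (2 * e ^ 3)) ≤
      exp (-2 : ℤ) := by
  intro hle
  set N : k[X] := C (shortWeierstrass c d).Δ * (X ^ i) ^ 2
    + C (864 * b * d - 2 * e ^ 3) * X ^ i + C (shortWeierstrass a b).Δ with hN
  have hX : (RatFunc.X : RatFunc k) ^ i ≠ 0 := pow_ne_zero _ RatFunc.X_ne_zero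
  have hNB : algebraMap k[X] (RatFunc k) N =
      (kuwataB a b c d (RatFunc.X ^ i) - RatFunc.C (2 * e ^ 3)) * RatFunc.X ^ i := by
    simp only [hN, map_add, map_mul, map_sub, map_pow, RatFunc.algebraMap_C, RatFunc.algebraMap_X,
      kuwataB]
    field_simp
    ring
  have hdvd : (X - C t₀) ^ 2 ∣ N := by
    apply sq_dvd_of_placeValuation_le
    rwa [hNB, map_mul, map_pow, placeValuation_X ht, one_pow, mul_one]
  obtain ⟨M, hM⟩ := hdvd
  have h0 : N.eval t₀ = 0 := by simp [hM]
  have h1 : (derivative N).eval t₀ = 0 := by simp [hM, derivative_pow]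
  set s := t₀ ^ i with hs
  have h0' : (shortWeierstrass c d).Δ * s ^ 2 + (864 * b * d - 2 * e ^ 3) * s
      + (shortWeierstrass a b).Δ = 0 := by
    simpa only [hN, eval_add, eval_mul, eval_C, eval_pow, eval_X] using h0
  -- The map `t ↦ tⁱ` is unramified at `t₀ ≠ 0`, so the double zero descends to the quadratic in
  -- `s`.
  have h1' : 2 * (shortWeierstrass c d).Δ * s + (864 * b * d - 2 * e ^ 3) = 0 := by
    have hne' : (i : k) * t₀ ^ (i - 1) ≠ 0 :=
      mul_ne_zero (Nat.cast_ne_zero.mpr (by omega)) (pow_ne_zero _ ht)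
    apply mul_right_cancel₀ hne'
    rw [zero_mul, ← h1, hN]
    simp only [derivative_add, derivative_mul, derivative_C, derivative_pow,
      derivative_X, eval_add, eval_mul, eval_C, eval_pow, eval_X, eval_zero,
      eval_one, hs]
    ring
  have hdisc : (864 * b * d - 2 * e ^ 3) ^ 2 =
      4 * (shortWeierstrass c d).Δ * (shortWeierstrass a b).Δ := by
    linear_combination (-4 * (shortWeierstrass c d).Δ) * h0' +
      (2 * (shortWeierstrass c d).Δ * s + (864 * b * d - 2 * e ^ 3)) * h1'
  rw [shortWeierstrass_Δ, shortWeierstrass_Δ] at hdisc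
  have he2 : e ^ 2 = 16 * a * c := by linear_combination he / 3
  have he6 : (e ^ 3) ^ 2 = (16 * a * c) ^ 3 := by rw [← he2]; ring
  have hlin : 32 * (a ^ 3 * d ^ 2 + b ^ 2 * c ^ 3) = -(b * d * e ^ 3) := by
    linear_combination (-1 / 3456) * hdisc + (1 / 864) * he6
  apply hne
  -- With `u = a³d²` and `w = b²c³`, squaring `hlin` and using `e⁶ = (16ac)³` gives `(u + w)² =
  -- 4uw`.
  have hsq : (a ^ 3 * d ^ 2 - b ^ 2 * c ^ 3) ^ 2 = 0 := by
    linear_combination (1 / 1024) * (32 * (a ^ 3 * d ^ 2 + b ^ 2 * c ^ 3) - b * d * e ^ 3) * hlin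
      + (1 / 1024) * (b * d) ^ 2 * he6
  exact sub_eq_zero.mp (pow_eq_zero_iff two_ne_zero |>.mp hsq)

/-- A torsion section does not pass through a singular point of a fibre away from `0` and `∞`. -/
theorem not_both_lt_one [CharZero k] {a b c d : k} (hne : a ^ 3 * d ^ 2 ≠ b ^ 2 * c ^ 3)
    {i : ℕ} (hi : 1 ≤ i) {t₀ : k} (ht : t₀ ≠ 0) {x y : RatFunc k}
    (h : y ^ 2 = x ^ 3 + RatFunc.C (-48 * a * c) * x + kuwataB a b c d (RatFunc.X ^ i))
    (hx : placeValuation t₀ x ≤ 1) (hy : placeValuation t₀ y < 1) :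
    ¬ placeValuation t₀ (3 * x ^ 2 + RatFunc.C (-48 * a * c)) < 1 := by
  intro htan
  obtain ⟨e, he⟩ := exists_placeValuation_sub_C_lt hx
  have he' : 3 * e ^ 2 + -48 * a * c = 0 := by
    apply eq_zero_of_placeValuation_C_lt_one (t₀ := t₀)
    have : RatFunc.C (3 * e ^ 2 + -48 * a * c) = 3 * x ^ 2 + RatFunc.C (-48 * a * c)
        - RatFunc.C 3 * (x + RatFunc.C e) * (x - RatFunc.C e) := by
      simp only [map_add, map_mul, map_pow, map_ofNat]
      ring
    rw [this]
    refine Valuation.map_sub_lt _ htan ?_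
    rw [map_mul]
    refine (mul_le_of_le_one_left zero_le ?_).trans_lt he
    rw [map_mul]
    exact mul_le_one' (placeValuation_C_le_one _ _)
      (Valuation.map_add_le _ hx (placeValuation_C_le_one _ _))
  refine not_placeValuation_kuwataB_sub_C_le hne hi ht he' ?_
  have hsq : ∀ z : RatFunc k, placeValuation t₀ z < 1 →
      placeValuation t₀ (z ^ 2) ≤ exp (-2 : ℤ) := by
    intro z hz
    have hz' : placeValuation t₀ z ≤ exp (-1 : ℤ) := by
      rcases eq_or_ne (placeValuation t₀ z) 0 with h0 | h0
      · rw [h0]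
        exact zero_le
      · rw [← exp_log h0, ← exp_zero, exp_lt_exp] at hz
        rw [← exp_log h0, exp_le_exp]
        omega
    rw [map_pow]
    calc _ ≤ exp (-1 : ℤ) ^ 2 := pow_le_pow_left₀ zero_le hz' 2
      _ = _ := by rw [← exp_nsmul]; rfl
  -- Since `A = -3e²`, the cubic `x³ + Ax + 2e³` factors as `(x + 2e)(x - e)²`; both `y` and `x - e`
  -- vanish at `t₀`.
  have hkey : kuwataB a b c d (RatFunc.X ^ i) - RatFunc.C (2 * e ^ 3) =
      y ^ 2 - (x + RatFunc.C (2 * e)) * (x - RatFunc.C e) ^ 2 := by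
    have he'' : RatFunc.C (-48 * a * c) = -(3 * RatFunc.C e ^ 2) := by
      rw [show -48 * a * c = -(3 * e ^ 2) by linear_combination he']
      simp only [map_neg, map_mul, map_pow, map_ofNat]
    rw [he''] at h
    simp only [map_mul, map_pow, map_ofNat]
    linear_combination -h
  rw [hkey]
  refine (Valuation.map_sub _ _ _).trans (max_le (hsq y hy) ?_)
  rw [map_mul]
  exact (mul_le_of_le_one_left zero_le
    (Valuation.map_add_le _ hx (placeValuation_C_le_one _ _))).trans (hsq _ he)

theorem one_lt_valuation_of_isOfFinAddOrder {F : Type*} [Field F] [DecidableEq F] [CharZero F]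
    {Γ₀ : Type*} [LinearOrderedCommGroupWithZero Γ₀] (v : Valuation F Γ₀) {A B x y : F}
    (hv : ∀ n : ℕ, n ≠ 0 → v n = 1) (hA : v A ≤ 1) (hB : 1 < v B)
    {h : (shortWeierstrass A B).toAffine.Nonsingular x y}
    (hfin : IsOfFinAddOrder (Affine.Point.some x y h)) :
    1 < v (if y = 0 then 3 * x ^ 2 + A else y) := by
  have h3 : v 3 = 1 := by simpa using hv 3 (by norm_num)
  split_ifs with hy
  · have hx3 := valuation_cube_eq_of_sq_lt v hA hB (shortWeierstrass_equation_iff.mp h.1)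
      (valuation_cube_le_of_isOfFinAddOrder v hv hA hB hfin)
      (by simpa [hy] using zero_lt_one.trans hB)
    have hx1 : 1 < v x := by
      by_contra! h1
      exact (hB.trans_le (hx3 ▸ pow_le_one₀ zero_le h1)).false
    have hx2 : 1 < v x ^ 2 := one_lt_pow₀ hx1 (by norm_num)
    rwa [v.map_add_eq_of_lt_left, map_mul, h3, one_mul, map_pow]
    rw [map_mul, h3, one_mul, map_pow]
    exact hA.trans_lt hx2
  · have hy2 := valuation_sq_eq_of_isOfFinAddOrder v hv hA hB hfin hy
    by_contra! h1
    exact (hB.trans_le (hy2 ▸ pow_le_one₀ zero_le h1)).false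

theorem not_isOfFinAddOrder [CharZero k] [IsAlgClosed k] [DecidableEq (RatFunc k)] {a b c d : k}
    (hE : (shortWeierstrass a b).Δ ≠ 0) (hF : (shortWeierstrass c d).Δ ≠ 0)
    (hne : a ^ 3 * d ^ 2 ≠ b ^ 2 * c ^ 3) {i : ℕ} (hi : 1 ≤ i) {x y : RatFunc k}
    (h : (kuwataCurve a b c d i).toAffine.Nonsingular x y) :
    ¬ IsOfFinAddOrder (Affine.Point.some x y h) := by
  intro hfin
  have : CharZero (RatFunc k) := charZero_of_injective_algebraMap (RatFunc.C (K := k)).injective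
  have hzero := one_lt_valuation_of_isOfFinAddOrder (placeValuation 0) (placeValuation_natCast 0)
    (placeValuation_C_le_one _ _) (one_lt_placeValuation_zero_kuwataB hE hi) hfin
  have hinfty := one_lt_valuation_of_isOfFinAddOrder (RatFunc.inftyValuation k)
    inftyValuation_natCast (inftyValuation_C_le_one _) (one_lt_inftyValuation_kuwataB hF hi) hfin
  -- Poles at both `0` and `∞` are incompatible with `f` being a unit everywhere else, which remains
  -- to be checked.
  refine (one_lt_mul'' hzero hinfty).ne' (placeValuation_zero_mul_inftyValuation fun t₀ ht => ?_)
  have hA := placeValuation_C_le_one t₀ (-48 * a * c)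
  have hB := placeValuation_kuwataB_le_one a b c d i ht
  have hv := placeValuation_natCast t₀
  have heq := shortWeierstrass_equation_iff.mp h.1
  have hx := valuation_le_one_of_isOfFinAddOrder _ hv hA hB hfin
  split_ifs with hy
  · refine le_antisymm (Valuation.map_add_le _ ?_ hA)
      (not_lt.mp (not_both_lt_one hne hi ht heq hx (by simp [hy])))
    rw [map_mul, map_pow]
    exact mul_le_one' (hv 3 three_ne_zero).le (pow_le_one₀ zero_le hx)
  · refine le_antisymm ?_ (not_lt.mp fun hlt => not_both_lt_one hne hi ht heq hx hlt
      (valuation_tangent_lt_one _ hv hA hB hfin hy hlt))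
    rw [← pow_le_one_iff_of_nonneg zero_le two_ne_zero, ← map_pow, heq]
    refine Valuation.map_add_le _ (Valuation.map_add_le _ ?_ ?_) hB
    · rw [map_pow]
      exact pow_le_one₀ zero_le hx
    · rw [map_mul]
      exact mul_le_one' hA hx

theorem cross_ne_of_j_ne {K : Type*} [Field K] (a b c d : K)
    [(shortWeierstrass a b).IsElliptic] [(shortWeierstrass c d).IsElliptic]
    (hj : (shortWeierstrass a b).j ≠ (shortWeierstrass c d).j) :
    a ^ 3 * d ^ 2 ≠ b ^ 2 * c ^ 3 := by
  intro h
  apply hj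
  have hE := (shortWeierstrass a b).isUnit_Δ.ne_zero
  have hF := (shortWeierstrass c d).isUnit_Δ.ne_zero
  rw [j, j, Units.val_inv_eq_inv_val, Units.val_inv_eq_inv_val, coe_Δ', coe_Δ',
    inv_mul_eq_div, inv_mul_eq_div, div_eq_div_iff hE hF, shortWeierstrass_Δ, shortWeierstrass_Δ]
  simp only [shortWeierstrass, c₄, b₂, b₄]
  linear_combination (-16 * 27 * (-48) ^ 3) * h

end Kuwata

theorem mainTheorem9 {K : Type*} [Field K] [CharZero K] (a b c d : K)
    [(shortWeierstrass a b).IsElliptic] [(shortWeierstrass c d).IsElliptic]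
    (hj : (shortWeierstrass a b).j ≠ (shortWeierstrass c d).j) (i : ℕ) (hi : 1 ≤ i) :
    IsAddTorsionFree (KuwataMW a b c d i) := by
  classical
  have hinj := (algebraMap K (AlgebraicClosure K)).injective
  have hchar : CharZero (AlgebraicClosure K) := charZero_of_injective_algebraMap hinj
  have hΔ : ∀ p q : K, (shortWeierstrass p q).Δ ≠ 0 →
      (shortWeierstrass (algebraMap K (AlgebraicClosure K) p)
        (algebraMap K (AlgebraicClosure K) q)).Δ ≠ 0 := by
    intro p q hpq
    rw [Kuwata.shortWeierstrass_Δ] at hpq ⊢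
    rw [← map_ne_zero (algebraMap K (AlgebraicClosure K))] at hpq
    simpa only [map_mul, map_add, map_pow, map_neg, map_ofNat] using hpq
  have hne := Kuwata.cross_ne_of_j_ne a b c d hj
  rw [← hinj.ne_iff, map_mul, map_mul, map_pow, map_pow, map_pow, map_pow] at hne
  rw [isAddTorsionFree_iff_not_isOfFinAddOrder]
  rintro (_ | ⟨x, y, h⟩) hP
  · exact absurd rfl hP
  · exact Kuwata.not_isOfFinAddOrder (hΔ a b (shortWeierstrass a b).isUnit_Δ.ne_zero)
      (hΔ c d (shortWeierstrass c d).isUnit_Δ.ne_zero) hne hi h
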